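/- We consider first-order logic over signatures that consist of constant symbols and of relation symbols of arity at least $1$, without function symbols of positive arity; the logical symbols are $=,\bot,\top,\neg,\wedge,\vee,\rightarrow,\leftrightarrow,\forall,\exists$. Structures have non-empty domains. Write $\mathrm{fv}(\psi)$ for the set of free variables of $\psi$, and $|\varphi|$ for the (uniform) length of $\varphi$, that is, the total number of occurrences of symbols (parentheses, logical symbols, variables, relation symbols and constants) in $\varphi$, each occurrence counting $1$. The \emph{Triguarded Fragment} (TGF) is the smallest set of formulas such that: (i) every atomic formula (including equalities) is in TGF; (ii) TGF is closed under Boolean connectives; (iii) if $\bar x$ is a tuple of variables, $\psi$ is in TGF, and $\gamma$ is an atomic formula with $\mathrm{fv}(\psi)\subseteq\mathrm{fv}(\gamma)$ and $\bar x\subseteq\mathrm{fv}(\gamma)$, then $\exists\bar x\,(\gamma\wedge\psi)$ and $\forall\bar x\,(\gamma\rightarrow\psi)$ are in TGF; (iv) if $x,y$ are variables and $\psi$ is in TGF with $\mathrm{fv}(\psi)\subseteq\{x,y\}$, then $\exists x\,\psi$ and $\forall x\,\psi$ are in TGF. **Theorem 3.** There exists a universal constant $C>0$ such that the following holds. Let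 $\varphi$ be a satisfiable equality-free sentence of TGF. Then $\varphi$ has a finite model whose domain size is at most \[ 2^{2^{\,C\cdot|\varphi|\cdot\log|\varphi|}}. \] -/

import Mathlib

universe u v w

namespace TGF

/-- Terms of function-free first-order logic: variables (named by natural numbers) and constant
symbols of the signature `L`. -/
inductive Term (L : FirstOrder.Language.{u, v}) : Type u
  | var (x : ℕ) : Term L
  | const (c : L.Constants) : Term L

/-- First-order formulas over the relation and constant symbols of `L`, with named variables and
with all connectives and quantifiers primitive. -/
inductive Formula (L : FirstOrder.Language.{u, v}) : Type (max u v)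
  | top : Formula L
  | bot : Formula L
  | eq (s t : Term L) : Formula L
  | rel {n : ℕ} (R : L.Relations n) (ts : Fin n → Term L) : Formula L
  | not (φ : Formula L) : Formula L
  | and (φ ψ : Formula L) : Formula L
  | or (φ ψ : Formula L) : Formula L
  | imp (φ ψ : Formula L) : Formula L
  | iff (φ ψ : Formula L) : Formula L
  | ex (x : ℕ) (φ : Formula L) : Formula L
  | all (x : ℕ) (φ : Formula L) : Formula L

variable {L : FirstOrder.Language.{u, v}}

/-- The set of variables of a term. -/
def Term.fv : Term L → Finset ℕ
  | .var x => {x}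
  | .const _ => ∅

/-- The value of a term under an assignment. -/
def Term.val {M : Type w} [L.Structure M] (f : ℕ → M) : Term L → M
  | .var x => f x
  | .const c => (c : M)

namespace Formula

/-- The set of free variables of a formula. -/
def fv : Formula L → Finset ℕ
  | top => ∅
  | bot => ∅
  | eq s t => s.fv ∪ t.fv
  | rel _ ts => Finset.univ.biUnion fun i => (ts i).fv
  | not φ => φ.fv
  | and φ ψ => φ.fv ∪ ψ.fv
  | or φ ψ => φ.fv ∪ ψ.fv
  | imp φ ψ => φ.fv ∪ ψ.fv
  | iff φ ψ => φ.fv ∪ ψ.fv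
  | ex x φ => φ.fv.erase x
  | all x φ => φ.fv.erase x

/-- A sentence is a formula without free variables. -/
def IsSentence (φ : Formula L) : Prop := φ.fv = ∅

/-- The uniform length: the number of occurrences of symbols (parentheses, logical symbols,
variables, relation symbols and constants), each counted once, in the words
`R ( t₁ … tₙ )`, `s = t`, `¬ φ`, `( φ ∧ ψ )`, `∃ x φ`, and so on. -/
def length : Formula L → ℕ
  | top => 1
  | bot => 1
  | eq _ _ => 3
  | rel (n := n) _ _ => n + 3
  | not φ => φ.length + 1
  | and φ ψ => φ.length + ψ.length + 3
  | or φ ψ => φ.length + ψ.length + 3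
  | imp φ ψ => φ.length + ψ.length + 3
  | iff φ ψ => φ.length + ψ.length + 3
  | ex _ φ => φ.length + 2
  | all _ φ => φ.length + 2

/-- Tarski semantics: the formula holds in the structure `M` under the assignment `f`. -/
def Realize {M : Type w} [L.Structure M] : Formula L → (ℕ → M) → Prop
  | top, _ => True
  | bot, _ => False
  | eq s t, f => s.val f = t.val f
  | rel R ts, f => FirstOrder.Language.Structure.RelMap R fun i => (ts i).val f
  | not φ, f => ¬ φ.Realize f
  | and φ ψ, f => φ.Realize f ∧ ψ.Realize f
  | or φ ψ, f => φ.Realize f ∨ ψ.Realize f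
  | imp φ ψ, f => φ.Realize f → ψ.Realize f
  | iff φ ψ, f => (φ.Realize f ↔ ψ.Realize f)
  | ex x φ, f => ∃ a : M, φ.Realize (Function.update f x a)
  | all x φ, f => ∀ a : M, φ.Realize (Function.update f x a)

/-- The structure `M` is a model of `φ`. It is used for sentences and nonempty `M`, where the
assignment does not matter. -/
def HasModel (φ : Formula L) (M : Type w) [L.Structure M] : Prop := ∀ f : ℕ → M, φ.Realize f

/-- No equality atom occurs in the formula. -/
def EqFree : Formula L → Prop
  | top => True
  | bot => True
  | eq _ _ => False
  | rel _ _ => True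
  | not φ => φ.EqFree
  | and φ ψ => φ.EqFree ∧ ψ.EqFree
  | or φ ψ => φ.EqFree ∧ ψ.EqFree
  | imp φ ψ => φ.EqFree ∧ ψ.EqFree
  | iff φ ψ => φ.EqFree ∧ ψ.EqFree
  | ex _ φ => φ.EqFree
  | all _ φ => φ.EqFree

/-- Atomic formulas, with equality atoms. -/
inductive IsAtom : Formula L → Prop
  | eq (s t : Term L) : IsAtom (eq s t)
  | rel {n : ℕ} (R : L.Relations n) (ts : Fin n → Term L) : IsAtom (rel R ts)

/-- The formula `∃ x₁ … ∃ xₙ φ`. -/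
def exs (xs : List ℕ) (φ : Formula L) : Formula L := xs.foldr ex φ

/-- The formula `∀ x₁ … ∀ xₙ φ`. -/
def alls (xs : List ℕ) (φ : Formula L) : Formula L := xs.foldr all φ

/-- The Triguarded Fragment (with equality): the rules of the Guarded Fragment, and unguarded
quantification of formulas whose free variables are among the quantified variable and one more. -/
inductive IsTGF : Formula L → Prop
  | atom {φ : Formula L} : IsAtom φ → IsTGF φ
  | top : IsTGF top
  | bot : IsTGF bot
  | not {φ : Formula L} : IsTGF φ → IsTGF (not φ)
  | and {φ ψ : Formula L} : IsTGF φ → IsTGF ψ → IsTGF (and φ ψ)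
  | or {φ ψ : Formula L} : IsTGF φ → IsTGF ψ → IsTGF (or φ ψ)
  | imp {φ ψ : Formula L} : IsTGF φ → IsTGF ψ → IsTGF (imp φ ψ)
  | iff {φ ψ : Formula L} : IsTGF φ → IsTGF ψ → IsTGF (iff φ ψ)
  | guardedEx (xs : List ℕ) {γ ψ : Formula L} : IsAtom γ → IsTGF ψ → ψ.fv ⊆ γ.fv →
      (∀ x ∈ xs, x ∈ γ.fv) → IsTGF (exs xs (and γ ψ))
  | guardedAll (xs : List ℕ) {γ ψ : Formula L} : IsAtom γ → IsTGF ψ → ψ.fv ⊆ γ.fv →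
      (∀ x ∈ xs, x ∈ γ.fv) → IsTGF (alls xs (imp γ ψ))
  | pairEx (x y : ℕ) {ψ : Formula L} : IsTGF ψ → ψ.fv ⊆ {x, y} → IsTGF (ex x ψ)
  | pairAll (x y : ℕ) {ψ : Formula L} : IsTGF ψ → ψ.fv ⊆ {x, y} → IsTGF (all x ψ)

end Formula

end TGF

/-! Fix a model `M` of `φ`. The new domain is `K ⊕ P`, where `K` lists the occurrences of constants
in `φ` and `P` is a set of `2 ^ (4 * q)` points. A local map sends a set of points to `M` so that
the chosen atomic facts over that set are exactly those read off in `M`. Besides relation symbols,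
every subformula of `φ` counts as a relation on its free variables, so the facts also record which
subformulas hold. Local maps need not be injective, which is harmless without equality.

Three properties of the local maps suffice. Every pair of points carries one, which handles
unguarded quantifiers; every tuple satisfying an atom carries one, which handles guarded
quantifiers; and every local map on at most `w` points extends by a new point sent to any prescribed
element of `M`, which supplies witnesses. Truth then transfers between `K ⊕ P` and `M` by induction
on subformulas. A witness found in `K ⊕ P` may come with a different local map, but the recorded
subformulas force all local maps to agree on the truth of the quantified formula.

The facts are found by counting (`exists_valuation_extension`). Over `w` old points and one new
point there are at most `q` atoms, so a random valuation meets a given requirement at a given new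
point with probability at least `2 ^ (-q)`, independently for different new points; with `2 ^ (4 *
q)` points the union bound leaves a valuation meeting all requirements. Pairs without a local map
are then repaired, and atoms on larger unrealised supports are made false
(`exists_saturated_valuation`). Neither change destroys the extensions. Since `q` is exponential in
`n * log n` for length `n`, the domain is doubly exponential. -/

/-! ### Counting and the union bound -/

namespace TGF

/-- Among the Boolean functions on a finite type, those that differ from `t` somewhere on each of
the disjoint small sets `X b` are few. -/
theorem card_avoid_mul_le {α B : Type*} [Fintype α] [DecidableEq α] [DecidableEq B]
    (X : B → Finset α) (t : α → Bool) (q : ℕ) (hX : ∀ b, (X b).card ≤ q) (T : Finset B)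
    (hT : ∀ b ∈ T, ∀ c ∈ T, b ≠ c → Disjoint (X b) (X c)) :
    (Finset.univ.filter fun ω : α → Bool => ∀ b ∈ T, ∃ a ∈ X b, ω a ≠ t a).card
        * (2 ^ q) ^ T.card ≤ (2 ^ q - 1) ^ T.card * 2 ^ Fintype.card α := by
  induction T using Finset.induction_on with
  | empty => simp
  | insert b T hb ih =>
    have ih := ih fun c hc d hd => hT c (Finset.mem_insert_of_mem hc) d (Finset.mem_insert_of_mem hd)
    set G := Finset.univ.filter fun ω : α → Bool => ∀ b ∈ T, ∃ a ∈ X b, ω a ≠ t a with hG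
    have hsplit : (G.filter fun ω => ∀ a ∈ X b, ω a = t a).card +
        (G.filter fun ω => ¬ ∀ a ∈ X b, ω a = t a).card = G.card :=
      Finset.card_filter_add_card_filter_not _
    have hbad : (Finset.univ.filter fun ω : α → Bool =>
        ∀ c ∈ insert b T, ∃ a ∈ X c, ω a ≠ t a) = G.filter fun ω => ¬ ∀ a ∈ X b, ω a = t a := by
      ext ω
      simp [hG, and_comm]
    -- Overwriting `ω` by `t` on `X b` has fibres of size at most `2 ^ q`; by disjointness it keeps
    -- the conditions at the other sets.
    have hle : G.card ≤ 2 ^ q * (G.filter fun ω => ∀ a ∈ X b, ω a = t a).card := by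
      apply Finset.card_le_mul_card_image_of_maps_to
        (f := fun (ω : α → Bool) a => if a ∈ X b then t a else ω a)
      · intro ω hω
        simp only [hG, Finset.mem_filter, Finset.mem_univ, true_and] at hω ⊢
        refine ⟨fun c hc => ?_, fun a ha => by simp [ha]⟩
        obtain ⟨a, ha, hne⟩ := hω c hc
        refine ⟨a, ha, ?_⟩
        have hbc : b ≠ c := by rintro rfl; exact hb hc
        have := Finset.disjoint_right.1 (hT b (Finset.mem_insert_self _ _) c
          (Finset.mem_insert_of_mem hc) hbc) ha
        simpa [this] using hne
      · intro σ _
        calc _ ≤ (Finset.univ : Finset (X b → Bool)).card := by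
              apply Finset.card_le_card_of_injOn (fun ω (a : X b) => ω a) (by simp)
              intro ω hω ω' hω' h
              simp only [Finset.coe_filter, Set.mem_ofPred_eq] at hω hω'
              have h1 := hω.2.trans hω'.2.symm
              funext a
              by_cases ha : a ∈ X b
              · exact congrFun h ⟨a, ha⟩
              · simpa [ha] using congrFun h1 a
          _ = 2 ^ (X b).card := by simp
          _ ≤ 2 ^ q := Nat.pow_le_pow_right two_pos (hX b)
    rw [hbad, Finset.card_insert_of_notMem hb, pow_succ, pow_succ]
    set g := (G.filter fun ω => ¬ ∀ a ∈ X b, ω a = t a).card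
    set g' := (G.filter fun ω => ∀ a ∈ X b, ω a = t a).card
    have h1 : 1 ≤ 2 ^ q := Nat.one_le_two_pow
    have h2 : g * 2 ^ q ≤ (2 ^ q - 1) * G.card := by
      rw [Nat.sub_mul, one_mul]
      have : 2 ^ q * G.card = 2 ^ q * g' + g * 2 ^ q := by rw [← hsplit]; ring
      omega
    calc g * ((2 ^ q) ^ T.card * 2 ^ q) = g * 2 ^ q * (2 ^ q) ^ T.card := by ring
      _ ≤ (2 ^ q - 1) * G.card * (2 ^ q) ^ T.card := Nat.mul_le_mul_right _ h2
      _ = (2 ^ q - 1) * (G.card * (2 ^ q) ^ T.card) := by ring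
      _ ≤ (2 ^ q - 1) * ((2 ^ q - 1) ^ T.card * 2 ^ Fintype.card α) := Nat.mul_le_mul_left _ ih
      _ = _ := by ring

/-- The first two terms of the binomial expansion of `((N - 1) + 1) ^ N` already suffice, as the
second is at least the first. -/
theorem two_mul_pred_pow_self_le (N : ℕ) (hN : 1 ≤ N) : 2 * (N - 1) ^ N ≤ N ^ N := by
  obtain ⟨k, rfl⟩ : ∃ k, N = k + 1 := ⟨N - 1, by omega⟩
  simp only [Nat.add_sub_cancel]
  have h : (k : ℕ) ^ (k + 1) + (k + 1) * k ^ k ≤ (k + 1) ^ (k + 1) := by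
    have := pow_add_mul_le_add_pow (a := k) (b := 1) (Nat.zero_le _) (Nat.zero_le _) (k + 1)
    simpa using this
  have : k ^ (k + 1) ≤ (k + 1) * k ^ k := by
    rw [pow_succ, mul_comm]; exact Nat.mul_le_mul_right _ (Nat.le_succ k)
  omega

/-- The numerical side of the union bound. -/
theorem union_bound_lt (q w : ℕ) (hq : 1 ≤ q) (hw : w ≤ q) :
    (2 ^ (4 * q)) ^ w * 2 ^ q * (2 ^ q - 1) ^ (2 ^ (4 * q) - w) <
      (2 ^ q) ^ (2 ^ (4 * q) - w) := by
  set N := 2 ^ q with hN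
  have hN2 : 2 ≤ N := by
    calc 2 = 2 ^ 1 := rfl
      _ ≤ N := Nat.pow_le_pow_right two_pos hq
  have hqN : q < N := Nat.lt_two_pow_self
  -- `2 ^ r` is twice the number `(2 ^ (4 * q)) ^ w * 2 ^ q` of requirements; each of `r` blocks of
  -- `N` factors gains a factor 2.
  set r := 4 * q * w + q + 1 with hr
  have hpow : 2 ^ (4 * q) = N ^ 4 := by rw [hN, ← pow_mul]; ring_nf
  have hrN : N * r + w ≤ N ^ 4 := by
    have h1 : 4 * q * w ≤ 4 * q * q := Nat.mul_le_mul_left _ hw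
    have hq2 : q * q + 1 ≤ N * N := by nlinarith
    have hqq : 4 * q * q + q + 2 ≤ N ^ 3 := by
      clear h1 hr r hpow hw w hqN hq2 hN2
      rw [hN, ← pow_mul, mul_comm q 3, pow_mul]
      norm_num
      clear hN N
      induction q, hq using Nat.le_induction with
      | base => norm_num
      | succ n hn ih => rw [pow_succ]; nlinarith
    calc N * r + w ≤ N * (4 * q * q + q + 1) + N * 1 := by
          rw [hr]; gcongr; omega
      _ = N * (4 * q * q + q + 2) := by ring
      _ ≤ N * N ^ 3 := Nat.mul_le_mul_left _ hqq
      _ = N ^ 4 := by ring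
  obtain ⟨s, hs⟩ : ∃ s, 2 ^ (4 * q) - w = N * r + s := ⟨2 ^ (4 * q) - w - N * r, by omega⟩
  rw [hs, pow_add (N - 1), pow_add N, pow_mul (N - 1), pow_mul N]
  have h1 : 2 ^ r * ((N - 1) ^ N) ^ r ≤ (N ^ N) ^ r := by
    rw [← mul_pow]
    exact Nat.pow_le_pow_left (two_mul_pred_pow_self_le N (by omega)) r
  have h2 : (N - 1) ^ s ≤ N ^ s := Nat.pow_le_pow_left (by omega) s
  have h3 : (2 ^ (4 * q)) ^ w * N * 2 = 2 ^ r := by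
    rw [hN, hr, ← pow_mul, pow_succ, pow_add]
  have h4 : 0 < ((N - 1) ^ N) ^ r := by
    have : 0 < N - 1 := by omega
    positivity
  have h5 : 0 < N ^ s := by positivity
  calc _ ≤ (2 ^ (4 * q)) ^ w * N * (((N - 1) ^ N) ^ r * N ^ s) :=
        Nat.mul_le_mul_left _ (Nat.mul_le_mul_left _ h2)
    _ < (2 ^ (4 * q)) ^ w * N * (((N - 1) ^ N) ^ r * N ^ s) * 2 := by
        have : 0 < (2 ^ (4 * q)) ^ w * N * (((N - 1) ^ N) ^ r * N ^ s) := by positivity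
        omega
    _ = 2 ^ r * ((N - 1) ^ N) ^ r * N ^ s := by rw [← h3]; ring
    _ ≤ _ := Nat.mul_le_mul_right _ h1

end TGF

/-! ### Valuations of atoms over finitely many points -/

namespace TGF

section Core

variable {ι : Type*} {ar : ι → Type*} {K A : Type*}

/-- Instances of the symbols in `ι` at tuples of constants from `K` and points from `P`. -/
abbrev AtomInst (ar : ι → Type*) (K P : Type*) := Σ i : ι, (ar i → K ⊕ P)

namespace AtomInst

/-- The points that occur in an atom. -/
noncomputable def supp [∀ i, Fintype (ar i)] {P : Type*} [Fintype P] (α : AtomInst ar K P) :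
    Finset P := by
  classical exact Finset.univ.filter fun p => ∃ j, α.2 j = Sum.inr p

@[simp] theorem mem_supp [∀ i, Fintype (ar i)] {P : Type*} [Fintype P] {α : AtomInst ar K P}
    {p : P} : p ∈ α.supp ↔ ∃ j, α.2 j = Sum.inr p := by
  simp [supp]

/-- The truth value of an atom in `A` when its points are sent to `A` by `h`. -/
def Holds (X : ∀ i, (ar i → A) → Prop) (κ : K → A) {P : Type*} (h : P → A)
    (α : AtomInst ar K P) : Prop := X α.1 fun j => Sum.elim κ h (α.2 j)

/-- Renaming of the points of an atom. -/
def map {P Q : Type*} (ρ : P → Q) (α : AtomInst ar K P) : AtomInst ar K Q :=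
  ⟨α.1, fun j => Sum.map id ρ (α.2 j)⟩

theorem holds_map (X : ∀ i, (ar i → A) → Prop) (κ : K → A) {P Q : Type*} (ρ : P → Q) (h : Q → A)
    (α : AtomInst ar K P) : (α.map ρ).Holds X κ h ↔ α.Holds X κ (h ∘ ρ) := by
  have : (fun j => Sum.elim κ h (Sum.map id ρ (α.2 j))) =
      fun j => Sum.elim κ (h ∘ ρ) (α.2 j) := by
    funext j
    cases α.2 j <;> rfl
  simp only [Holds, map, this]

variable [∀ i, Fintype (ar i)] {P : Type*} [Fintype P]

theorem holds_congr (X : ∀ i, (ar i → A) → Prop) (κ : K → A) {h h' : P → A}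
    {α : AtomInst ar K P} (H : ∀ p ∈ α.supp, h p = h' p) : α.Holds X κ h ↔ α.Holds X κ h' := by
  have : (fun j => Sum.elim κ h (α.2 j)) = fun j => Sum.elim κ h' (α.2 j) := by
    funext j
    rcases e : α.2 j with c | p
    · rfl
    · exact H p (mem_supp.2 ⟨j, e⟩)
  simp only [Holds, this]

theorem map_injOn {Q : Type*} {ρ : P → Q} {S : Finset P}
    (hρ : Set.InjOn ρ S) : Set.InjOn (map (ar := ar) (K := K) ρ) {α | α.supp ⊆ S} := by
  rintro ⟨i, x⟩ hx ⟨i', y⟩ hy h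
  obtain rfl : i = i' := congrArg Sigma.fst h
  have h := eq_of_heq (Sigma.mk.inj h).2
  congr 1
  funext j
  have hj := congrFun h j
  rcases e : x j with c | p <;> rcases e' : y j with d | r <;> simp [e, e'] at hj
  · rw [hj]
  · rw [hρ (hx (mem_supp.2 ⟨j, e⟩)) (hy (mem_supp.2 ⟨j, e'⟩)) hj]

/-- The valuation `v` is induced by `h` on the atoms with all points in `S`. -/
def Agree (X : ∀ i, (ar i → A) → Prop) (κ : K → A) (v : AtomInst ar K P → Prop)
    (S : Finset P) (h : P → A) : Prop :=
  ∀ α : AtomInst ar K P, α.supp ⊆ S → (v α ↔ α.Holds X κ h)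

/-- Replacement of the valuation `v` by the one induced by `e` on those supports of size `k` where
`v` is not induced by any map. -/
def repair (X : ∀ i, (ar i → A) → Prop) (κ : K → A) (k : ℕ) (e : P → A)
    (v : AtomInst ar K P → Prop) (α : AtomInst ar K P) : Prop :=
  (α.supp.card = k ∧ (¬ ∃ h, Agree X κ v α.supp h) ∧ α.Holds X κ e) ∨
    (¬ (α.supp.card = k ∧ ¬ ∃ h, Agree X κ v α.supp h) ∧ v α)

variable {X : ∀ i, (ar i → A) → Prop} {κ : K → A} {v : AtomInst ar K P → Prop} {k : ℕ}
  {e : P → A}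

theorem Agree.mono {S T : Finset P} {h : P → A} (H : Agree X κ v T h) (hST : S ⊆ T) :
    Agree X κ v S h := fun α hα => H α (hα.trans hST)

theorem Agree.congr {S : Finset P} {h h' : P → A} (H : Agree X κ v S h)
    (hh : ∀ p ∈ S, h p = h' p) : Agree X κ v S h' := fun α hα =>
  (H α hα).trans (holds_congr X κ fun p hp => hh p (hα hp))

theorem repair_of_card_ne {α : AtomInst ar K P} (hα : α.supp.card ≠ k) :
    repair X κ k e v α ↔ v α := by simp [repair, hα]

/-- Repair acts on whole supports at once, so a support that is already realised is left alone. This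
is what protects the extension property. -/
theorem repair_of_agree {α : AtomInst ar K P} {h : P → A} (H : Agree X κ v α.supp h) :
    repair X κ k e v α ↔ v α := by
  have : ∃ h, Agree X κ v α.supp h := ⟨h, H⟩
  simp [repair, this]

/-- Repair makes every set of size `k` realised, if its proper subsets are realised by `e`. -/
theorem exists_agree_repair {S : Finset P} (hS : S.card = k)
    (he : ∀ α : AtomInst ar K P, α.supp ⊂ S → (v α ↔ α.Holds X κ e)) :
    ∃ h, Agree X κ (repair X κ k e v) S h := by
  have hlt : ∀ α : AtomInst ar K P, α.supp ⊂ S → α.supp.card ≠ k := fun α hα =>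
    hS ▸ (Finset.card_lt_card hα).ne
  by_cases H : ∃ h, Agree X κ v S h
  · obtain ⟨h, H⟩ := H
    exact ⟨h, fun α hα => (repair_of_agree (H.mono hα)).trans (H α hα)⟩
  · refine ⟨e, fun α hα => ?_⟩
    rcases hα.eq_or_ssubset with h | h
    · simp [repair, h, hS, H]
    · rw [repair_of_card_ne (hlt α h), he α h]

/-- A valuation of atoms with the extension property. -/
theorem exists_valuation_extension [Fintype ι] [Fintype K] (X : ∀ i, (ar i → A) → Prop) (κ : K → A)
    (w q : ℕ)
    (hq : ∑ i : ι, (Fintype.card K + (w + 1)) ^ Fintype.card (ar i) ≤ q) (hw : w ≤ q)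
    (hq1 : 1 ≤ q) :
    ∃ ω : AtomInst ar K (Fin (2 ^ (4 * q))) → Bool,
      ∀ S : Finset (Fin (2 ^ (4 * q))), S.card ≤ w → ∀ (h : Fin (2 ^ (4 * q)) → A) (a : A),
        ∃ b ∉ S, ∀ α : AtomInst ar K (Fin (2 ^ (4 * q))), b ∈ α.supp → α.supp ⊆ insert b S →
          (ω α = true ↔ α.Holds X κ (Function.update h b a)) := by
  classical
  set m := 2 ^ (4 * q) with hm
  let P := Fin m
  -- The atoms decided by adding `b` to `S`. The value `∅` for `b ∈ S` only keeps the size bound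
  -- valid for every `b`.
  let Y : Finset P → P → Finset (AtomInst ar K P) := fun S b =>
    if b ∈ S then ∅ else Finset.univ.filter fun α => b ∈ α.supp ∧ α.supp ⊆ insert b S
  -- Collapsing all points outside `S` to `none` describes every new point over the same `w + 1`
  -- points, so there are at most `2 ^ q` requirements per `S`, whatever `m` is.
  let ρ : (S : Finset P) → P → Option S := fun S p => if hp : p ∈ S then some ⟨p, hp⟩ else none
  have hρ : ∀ (S : Finset P) (b : P), b ∉ S → Set.InjOn (ρ S) (insert b S : Finset P) := by
    intro S b hb p hp r hr hpr
    simp only [Finset.coe_insert, Set.mem_insert_iff, Finset.mem_coe] at hp hr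
    by_cases h1 : p ∈ S <;> by_cases h2 : r ∈ S <;> simp [ρ, h1, h2] at hpr hp hr
    · exact hpr
    · rw [hp, hr]
  have hcard : ∀ S : Finset P, S.card = w → Fintype.card (AtomInst ar K (Option S)) ≤ q := by
    intro S hS
    simpa [Fintype.card_sigma, hS] using hq
  have hYcard : ∀ S : Finset P, S.card = w → ∀ b, (Y S b).card ≤ q := by
    intro S hS b
    by_cases hb : b ∈ S
    · simp [Y, hb]
    · refine le_trans ?_ (hcard S hS)
      refine Finset.card_le_card_of_injOn (map (ρ S)) (by simp) ?_
      refine (map_injOn (hρ S b hb)).mono ?_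
      intro α hα
      simp only [Y, hb, if_false, Finset.coe_filter, Set.mem_ofPred_eq] at hα
      exact hα.2.2
  have hYdisj : ∀ (S : Finset P), ∀ b ∈ Sᶜ, ∀ c ∈ Sᶜ, b ≠ c → Disjoint (Y S b) (Y S c) := by
    intro S b hb c hc hbc
    rw [Finset.disjoint_left]
    intro α hα hα'
    rw [Finset.mem_compl] at hb hc
    simp only [Y, hb, hc, if_false, Finset.mem_filter, Finset.mem_univ, true_and] at hα hα'
    have := hα'.2 hα.1
    simp [hb, hbc] at this
  let Bad : (S : Finset P) → (AtomInst ar K (Option S) → Bool) →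
      Finset (AtomInst ar K P → Bool) := fun S τ =>
    Finset.univ.filter fun ω => ∀ b ∈ Sᶜ, ∃ α ∈ Y S b, ω α ≠ τ (α.map (ρ S))
  have hBad : ∀ S : Finset P, S.card = w → ∀ τ, (Bad S τ).card * (2 ^ q) ^ (m - w) ≤
      (2 ^ q - 1) ^ (m - w) * 2 ^ Fintype.card (AtomInst ar K P) := by
    intro S hS τ
    have := card_avoid_mul_le (Y S) (fun α => τ (α.map (ρ S))) q (hYcard S hS) Sᶜ (hYdisj S)
    rw [Finset.card_compl, hS, Fintype.card_fin] at this
    convert this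
  obtain ⟨ω, hω⟩ : ∃ ω : AtomInst ar K P → Bool, ∀ S : Finset P, S.card = w →
      ∀ τ, ω ∉ Bad S τ := by
    by_contra! hcon
    have hsub : (Finset.univ : Finset (AtomInst ar K P → Bool)) ⊆
        (Finset.univ.powersetCard w : Finset (Finset P)).biUnion fun S =>
          Finset.univ.biUnion (Bad S) := by
      intro ω _
      obtain ⟨S, hS, τ, h⟩ := hcon ω
      simp only [Finset.mem_biUnion, Finset.mem_powersetCard, Finset.mem_univ, true_and]
      exact ⟨S, ⟨Finset.subset_univ _, hS⟩, τ, h⟩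
    set a := 2 ^ Fintype.card (AtomInst ar K P) with ha
    have h1 : a * (2 ^ q) ^ (m - w) ≤ m ^ w * (2 ^ q * ((2 ^ q - 1) ^ (m - w) * a)) := by
      calc a * (2 ^ q) ^ (m - w)
          = (Finset.univ : Finset (AtomInst ar K P → Bool)).card * (2 ^ q) ^ (m - w) := by
            simp [ha]
        _ ≤ (∑ S ∈ (Finset.univ.powersetCard w : Finset (Finset P)), ∑ τ, (Bad S τ).card) *
              (2 ^ q) ^ (m - w) := by
            refine Nat.mul_le_mul_right _ ((Finset.card_le_card hsub).trans ?_)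
            exact Finset.card_biUnion_le.trans
              (Finset.sum_le_sum fun S _ => Finset.card_biUnion_le)
        _ = ∑ S ∈ (Finset.univ.powersetCard w : Finset (Finset P)), ∑ τ, (Bad S τ).card *
              (2 ^ q) ^ (m - w) := by simp only [Finset.sum_mul]
        _ ≤ ∑ S ∈ (Finset.univ.powersetCard w : Finset (Finset P)),
              2 ^ q * ((2 ^ q - 1) ^ (m - w) * a) := by
            refine Finset.sum_le_sum fun S hS => ?_
            have hS := (Finset.mem_powersetCard.1 hS).2
            refine (Finset.sum_le_card_nsmul _ _ _ fun τ _ => hBad S hS τ).trans ?_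
            rw [smul_eq_mul]
            refine Nat.mul_le_mul_right _ ?_
            rw [Finset.card_univ, Fintype.card_fun, Fintype.card_bool]
            exact Nat.pow_le_pow_right two_pos (hcard S hS)
        _ ≤ _ := by
            rw [Finset.sum_const, smul_eq_mul, Finset.card_powersetCard, Finset.card_univ,
              Fintype.card_fin]
            exact Nat.mul_le_mul_right _ (Nat.choose_le_pow m w)
    have h2 := union_bound_lt q w hq1 hw
    have ha0 : 0 < a := by positivity
    have h3 : a * (m ^ w * 2 ^ q * (2 ^ q - 1) ^ (m - w)) < a * (2 ^ q) ^ (m - w) :=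
      Nat.mul_lt_mul_of_pos_left h2 ha0
    have h4 : a * (m ^ w * 2 ^ q * (2 ^ q - 1) ^ (m - w)) =
      m ^ w * (2 ^ q * ((2 ^ q - 1) ^ (m - w) * a)) := by ring
    omega
  refine ⟨ω, fun S hS h a => ?_⟩
  have hwm : w ≤ m := hw.trans ((Nat.le_mul_of_pos_left q (by norm_num : 0 < 4)).trans
    Nat.lt_two_pow_self.le)
  -- The count concerned sets of size exactly `w`; smaller ones are padded.
  obtain ⟨T, hST, hT⟩ := Finset.exists_superset_card_eq hS (by simpa using hwm)
  have := hω T hT fun β => decide (β.Holds X κ fun o => o.elim a fun p => h p)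
  simp only [Bad, Finset.mem_filter, Finset.mem_univ, true_and, not_forall, not_exists, not_and,
    not_not, Finset.mem_compl] at this
  obtain ⟨b, hb, H⟩ := this
  refine ⟨b, fun hbS => hb (hST hbS), fun α hα hα' => ?_⟩
  have hαT : α.supp ⊆ insert b T := hα'.trans (Finset.insert_subset_insert b hST)
  rw [H α (by simpa [Y, hb] using ⟨mem_supp.1 hα, hαT⟩), decide_eq_true_iff, holds_map]
  refine holds_congr X κ fun p hp => ?_
  have hp := hαT hp
  rw [Finset.mem_insert] at hp
  rcases eq_or_ne p b with rfl | hpb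
  · simp [ρ, hb]
  · have hpT : p ∈ T := hp.resolve_left hpb
    simp [ρ, hpT, hpb]

end AtomInst

open AtomInst in
/-- A valuation of the atoms over finitely many points that is locally induced by maps to `A`: every
pair of points and every tuple that satisfies an atom is, and these maps extend by one point in all
possible ways. -/
theorem exists_saturated_valuation [Fintype ι] [Fintype K] [∀ i, Fintype (ar i)] [Nonempty A]
    (X : ∀ i, (ar i → A) → Prop) (κ : K → A) (w q : ℕ)
    (hq : ∑ i : ι, (Fintype.card K + (w + 1)) ^ Fintype.card (ar i) ≤ q) (hw : w ≤ q)
    (hq1 : 1 ≤ q) :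
    ∃ (v : ∀ i, (ar i → K ⊕ Fin (2 ^ (4 * q))) → Prop)
      (G : Finset (Fin (2 ^ (4 * q))) → (Fin (2 ^ (4 * q)) → A) → Prop),
      (∀ S h, G S h → ∀ i x, (∀ j p, x j = Sum.inr p → p ∈ S) →
        (v i x ↔ X i fun j => Sum.elim κ h (x j))) ∧
      (∀ S T h, G T h → S ⊆ T → G S h) ∧
      (∀ S : Finset _, S.card ≤ 2 → ∃ h, G S h) ∧
      (∀ i x, v i x → ∃ S h, G S h ∧ ∀ j p, x j = Sum.inr p → p ∈ S) ∧
      (∀ (S : Finset _) h, G S h → S.card ≤ w → ∀ a : A, ∃ b ∉ S,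
        G (insert b S) (Function.update h b a)) := by
  classical
  obtain ⟨ω, hω⟩ := exists_valuation_extension X κ w q hq hw hq1
  obtain ⟨a₀⟩ := ‹Nonempty A›
  let P := Fin (2 ^ (4 * q))
  -- Atoms without points speak of constants only, so their values must come from `A`; `a₀` plays no
  -- role in them.
  let v₀ : AtomInst ar K P → Prop := fun α =>
    (α.supp = ∅ ∧ α.Holds X κ fun _ => a₀) ∨ (α.supp ≠ ∅ ∧ ω α = true)
  have hv₀ : ∀ (α : AtomInst ar K P) (h : P → A), α.supp = ∅ → (v₀ α ↔ α.Holds X κ h) := by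
    intro α h hα
    have : v₀ α ↔ α.Holds X κ fun _ => a₀ := by simp [v₀, hα]
    rw [this]
    exact holds_congr X κ (by simp [hα])
  have hv₀' : ∀ (α : AtomInst ar K P) b, b ∈ α.supp → (v₀ α ↔ ω α = true) := by
    intro α b hb
    have : α.supp ≠ ∅ := Finset.ne_empty_of_mem hb
    simp [v₀, this]
  let v₁ := repair X κ 1 (fun _ => a₀) v₀
  have h₁ : ∀ p : P, ∃ h, Agree X κ v₁ {p} h := fun p => by
    refine exists_agree_repair (by simp) fun α hα => hv₀ α _ ?_
    simpa using hα
  choose g hg using h₁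
  -- The maps realising single points glue to one map, which realises all supports of size at most
  -- 1.
  let e : P → A := fun p => g p p
  have he : ∀ p, Agree X κ v₁ {p} e := fun p => (hg p).congr (by simp [e])
  let v₂ := repair X κ 2 e v₁
  have h₂ : ∀ S : Finset P, S.card ≤ 2 → ∃ h, Agree X κ v₂ S h := by
    intro S hS
    have key : ∀ α : AtomInst ar K P, α.supp.card < 2 → (v₁ α ↔ α.Holds X κ e) := by
      intro α hα
      rcases (by omega : α.supp.card = 0 ∨ α.supp.card = 1) with h | h
      · have hr : v₁ α ↔ v₀ α := repair_of_card_ne (by omega)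
        rw [hr]
        exact hv₀ α _ (Finset.card_eq_zero.1 h)
      · obtain ⟨p, hp⟩ := Finset.card_eq_one.1 h
        exact he p α hp.subset
    rcases hS.eq_or_lt with hS | hS
    · exact exists_agree_repair hS fun α hα => key α
        ((Finset.card_lt_card hα).trans_eq hS)
    · refine ⟨e, fun α hα => ?_⟩
      have h2 : α.supp.card < 2 := (Finset.card_le_card hα).trans_lt hS
      have hr : v₂ α ↔ v₁ α := repair_of_card_ne (by omega)
      rw [hr, key α h2]
  -- Atoms on unrealised supports are made false, so that every true atom is covered by a local map.
  -- Sets in `G` are unaffected, since all their subsets are realised.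
  refine ⟨fun i x => v₂ ⟨i, x⟩ ∧ ∃ h, Agree X κ v₂ (supp ⟨i, x⟩) h, Agree X κ v₂,
    ?_, fun S T h H hST => H.mono hST, h₂, ?_, ?_⟩
  · intro S h H i x hx
    have hsub : supp (⟨i, x⟩ : AtomInst ar K P) ⊆ S := by
      intro p hp
      obtain ⟨j, hj⟩ := mem_supp.1 hp
      exact hx j p hj
    have : ∃ h, Agree X κ v₂ (supp ⟨i, x⟩) h := ⟨h, H.mono hsub⟩
    simp only [this, and_true]
    exact H ⟨i, x⟩ hsub
  · rintro i x ⟨-, h, H⟩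
    exact ⟨_, h, H, fun j p hj => mem_supp.2 ⟨j, hj⟩⟩
  · intro S h H hS a
    obtain ⟨b, hb, hωb⟩ := hω S hS h a
    refine ⟨b, hb, ?_⟩
    set h' := Function.update h b a with hh'
    have hhh' : ∀ p ∈ S, h p = h' p := fun p hp => by
      have : p ≠ b := by rintro rfl; exact hb hp
      simp [hh', this]
    have H' := H.congr hhh'
    have new₀ : ∀ α : AtomInst ar K P, b ∈ α.supp → α.supp ⊆ insert b S →
        (v₀ α ↔ α.Holds X κ h') := fun α hα hα' => (hv₀' α b hα).trans (hωb α hα hα')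
    -- The random choice already makes the atoms at `b` agree with `h'`, so neither repair touches
    -- them.
    have new₁ : ∀ α : AtomInst ar K P, b ∈ α.supp → α.supp ⊆ insert b S →
        (v₁ α ↔ α.Holds X κ h') := by
      intro α hα hα'
      by_cases h1 : α.supp.card = 1
      · have hs : α.supp = {b} := by
          obtain ⟨p, hp⟩ := Finset.card_eq_one.1 h1
          rw [hp, Finset.mem_singleton] at hα
          rw [hp, hα]
        have : Agree X κ v₀ α.supp h' := by
          intro β hβ
          rw [hs, Finset.subset_singleton_iff] at hβ
          rcases hβ with hβ | hβ
          · exact hv₀ β h' hβ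
          · exact new₀ β (by simp [hβ]) (by simp [hβ])
        exact (repair_of_agree this).trans (new₀ α hα hα')
      · exact (repair_of_card_ne h1).trans (new₀ α hα hα')
    intro α hα
    by_cases hbα : b ∈ α.supp
    · by_cases h2 : α.supp.card = 2
      · have : Agree X κ v₁ α.supp h' := by
          intro β hβ
          by_cases hbβ : b ∈ β.supp
          · exact new₁ β hbβ (hβ.trans hα)
          · have hβS : β.supp ⊆ S := (Finset.subset_insert_iff_of_notMem hbβ).1 (hβ.trans hα)
            have hlt : β.supp.card < 2 := (Finset.card_lt_card
              (Finset.ssubset_iff_subset_ne.2 ⟨hβ, fun h => hbβ (h.symm ▸ hbα)⟩)).trans_eq h2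
            have hr : v₂ β ↔ v₁ β := repair_of_card_ne hlt.ne
            -- Atoms missing `b` in a two-point support have fewer than two points, so the second
            -- repair left them as `H'` describes.
            rw [← hr]
            exact H' β hβS
        exact (repair_of_agree this).trans (new₁ α hbα hα)
      · exact (repair_of_card_ne h2).trans (new₁ α hbα hα)
    · exact H' α ((Finset.subset_insert_iff_of_notMem hbα).1 hα)

end Core

end TGF

/-! ### Syntax and semantics of formulas -/

namespace TGF

variable {L : FirstOrder.Language.{u, v}}

theorem Term.val_congr {M : Type*} [L.Structure M] {f g : ℕ → M} (t : Term L)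
    (h : ∀ x ∈ t.fv, f x = g x) : t.val f = t.val g := by
  cases t with
  | var x => exact h x (by simp [Term.fv])
  | const c => rfl

/-- The constants of a term. -/
def Term.consts : Term L → List L.Constants
  | .var _ => []
  | .const c => [c]

theorem Term.length_consts_le (t : Term L) : t.consts.length ≤ 1 := by
  cases t <;> simp [Term.consts]

theorem Term.card_fv_le (t : Term L) : t.fv.card ≤ 1 := by
  cases t <;> simp [Term.fv]

namespace Formula

theorem realize_congr {M : Type*} [L.Structure M] (φ : Formula L) :
    ∀ {f g : ℕ → M}, (∀ x ∈ φ.fv, f x = g x) → (φ.Realize f ↔ φ.Realize g) := by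
  have upd : ∀ (φ : Formula L) (x : ℕ) (f g : ℕ → M), (∀ y ∈ φ.fv.erase x, f y = g y) →
      ∀ a, ∀ y ∈ φ.fv, Function.update f x a y = Function.update g x a y := by
    intro φ x f g h a y hy
    rcases eq_or_ne y x with rfl | hyx
    · simp
    · simpa [hyx] using h y (Finset.mem_erase.2 ⟨hyx, hy⟩)
  induction φ with
  | top => intro f g _; rfl
  | bot => intro f g _; rfl
  | eq s t =>
    intro f g h
    simp only [fv, Finset.mem_union] at h
    simp only [Realize, s.val_congr fun x hx => h x (Or.inl hx),
      t.val_congr fun x hx => h x (Or.inr hx)]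
  | rel R ts =>
    intro f g h
    have : (fun i => (ts i).val f) = fun i => (ts i).val g := funext fun i =>
      (ts i).val_congr fun x hx => h x (by simpa [fv] using ⟨i, hx⟩)
    simp only [Realize, this]
  | not φ ih => intro f g h; simp only [Realize, ih h]
  | and φ ψ ih₁ ih₂ | or φ ψ ih₁ ih₂ | imp φ ψ ih₁ ih₂ | iff φ ψ ih₁ ih₂ =>
    intro f g h
    simp only [fv, Finset.mem_union] at h
    simp only [Realize, ih₁ fun x hx => h x (Or.inl hx), ih₂ fun x hx => h x (Or.inr hx)]
  | ex x φ ih => intro f g h; exact exists_congr fun a => ih (upd φ x f g h a)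
  | all x φ ih => intro f g h; exact forall_congr' fun a => ih (upd φ x f g h a)

/-- The subformulas of a formula. -/
def subs : Formula L → List (Formula L)
  | top => [top]
  | bot => [bot]
  | eq s t => [eq s t]
  | rel R ts => [rel R ts]
  | not φ => not φ :: φ.subs
  | and φ ψ => and φ ψ :: (φ.subs ++ ψ.subs)
  | or φ ψ => or φ ψ :: (φ.subs ++ ψ.subs)
  | imp φ ψ => imp φ ψ :: (φ.subs ++ ψ.subs)
  | iff φ ψ => iff φ ψ :: (φ.subs ++ ψ.subs)
  | ex x φ => ex x φ :: φ.subs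
  | all x φ => all x φ :: φ.subs

/-- The occurrences of constants in a formula. -/
def consts : Formula L → List L.Constants
  | top => []
  | bot => []
  | eq s t => s.consts ++ t.consts
  | rel (n := n) _ ts => (List.finRange n).flatMap fun i => (ts i).consts
  | not φ => φ.consts
  | and φ ψ => φ.consts ++ ψ.consts
  | or φ ψ => φ.consts ++ ψ.consts
  | imp φ ψ => φ.consts ++ ψ.consts
  | iff φ ψ => φ.consts ++ ψ.consts
  | ex _ φ => φ.consts
  | all _ φ => φ.consts

theorem mem_subs_self (φ : Formula L) : φ ∈ φ.subs := by
  cases φ <;> simp [subs]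

theorem subs_subset {φ ψ : Formula L} (h : ψ ∈ φ.subs) : ψ.subs ⊆ φ.subs := by
  induction φ with
  | top | bot | eq | rel =>
    simp only [subs, List.mem_singleton] at h; subst h; exact List.Subset.refl _
  | not φ ih | ex x φ ih | all x φ ih =>
    simp only [subs, List.mem_cons] at h
    rcases h with rfl | h
    · exact List.Subset.refl _
    · exact fun χ hχ => List.mem_cons_of_mem _ (ih h hχ)
  | and φ χ ih₁ ih₂ | or φ χ ih₁ ih₂ | imp φ χ ih₁ ih₂ | iff φ χ ih₁ ih₂ =>
    simp only [subs, List.mem_cons, List.mem_append] at h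
    rcases h with rfl | h | h
    · exact List.Subset.refl _
    · exact fun θ hθ => List.mem_cons_of_mem _ (List.mem_append_left _ (ih₁ h hθ))
    · exact fun θ hθ => List.mem_cons_of_mem _ (List.mem_append_right _ (ih₂ h hθ))

theorem consts_subset {φ ψ : Formula L} (h : ψ ∈ φ.subs) : ψ.consts ⊆ φ.consts := by
  induction φ with
  | top | bot | eq | rel =>
    simp only [subs, List.mem_singleton] at h; subst h; exact List.Subset.refl _
  | not φ ih | ex x φ ih | all x φ ih =>
    simp only [subs, List.mem_cons] at h
    rcases h with rfl | h
    · exact List.Subset.refl _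
    · exact ih h
  | and φ χ ih₁ ih₂ | or φ χ ih₁ ih₂ | imp φ χ ih₁ ih₂ | iff φ χ ih₁ ih₂ =>
    simp only [subs, List.mem_cons, List.mem_append] at h
    rcases h with rfl | h | h
    · exact List.Subset.refl _
    · exact fun c hc => List.mem_append_left _ (ih₁ h hc)
    · exact fun c hc => List.mem_append_right _ (ih₂ h hc)

theorem EqFree.of_mem_subs {φ ψ : Formula L} (hφ : φ.EqFree) (h : ψ ∈ φ.subs) : ψ.EqFree := by
  induction φ with
  | top | bot | eq | rel => simp only [subs, List.mem_singleton] at h; subst h; exact hφ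
  | not φ ih | ex x φ ih | all x φ ih =>
    simp only [subs, List.mem_cons] at h
    rcases h with rfl | h
    · exact hφ
    · exact ih hφ h
  | and φ χ ih₁ ih₂ | or φ χ ih₁ ih₂ | imp φ χ ih₁ ih₂ | iff φ χ ih₁ ih₂ =>
    simp only [subs, List.mem_cons, List.mem_append] at h
    rcases h with rfl | h | h
    · exact hφ
    · exact ih₁ hφ.1 h
    · exact ih₂ hφ.2 h

theorem length_le_of_mem_subs {φ ψ : Formula L} (h : ψ ∈ φ.subs) : ψ.length ≤ φ.length := by
  induction φ with
  | top | bot | eq | rel => simp only [subs, List.mem_singleton] at h; subst h; rfl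
  | not φ ih | ex x φ ih | all x φ ih =>
    simp only [subs, List.mem_cons] at h
    rcases h with rfl | h
    · rfl
    · exact (ih h).trans (by simp [length])
  | and φ χ ih₁ ih₂ | or φ χ ih₁ ih₂ | imp φ χ ih₁ ih₂ | iff φ χ ih₁ ih₂ =>
    simp only [subs, List.mem_cons, List.mem_append] at h
    rcases h with rfl | h | h
    · rfl
    · exact (ih₁ h).trans (by simp only [length]; omega)
    · exact (ih₂ h).trans (by simp only [length]; omega)

theorem length_subs_le (φ : Formula L) : φ.subs.length ≤ φ.length := by
  induction φ <;> simp only [subs, length, List.length_cons, List.length_append,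
    List.length_nil] <;> omega

theorem length_consts_le (φ : Formula L) : φ.consts.length ≤ φ.length := by
  induction φ with
  | rel R ts =>
    rename_i n
    have : ((List.finRange n).map fun i => (ts i).consts.length).sum ≤ n := by
      refine (List.sum_le_card_nsmul _ 1 ?_).trans (by simp)
      intro x hx
      obtain ⟨i, -, rfl⟩ := List.mem_map.1 hx
      exact (ts i).length_consts_le
    simp only [consts, length, List.length_flatMap]
    omega
  | eq s t =>
    have := s.length_consts_le
    have := t.length_consts_le
    simp only [consts, length, List.length_append]; omega
  | _ => simp only [consts, length, List.length_append, List.length_nil]; omega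

theorem card_fv_le_length (φ : Formula L) : φ.fv.card ≤ φ.length := by
  induction φ with
  | top | bot => simp [fv]
  | eq s t =>
    have := s.card_fv_le
    have := t.card_fv_le
    have := Finset.card_union_le s.fv t.fv
    simp only [fv, length]; omega
  | rel R ts =>
    rename_i n
    have : (Finset.univ.biUnion fun i => (ts i).fv).card ≤ n := by
      refine (Finset.card_biUnion_le_card_mul _ _ 1 fun i _ => (ts i).card_fv_le).trans (by simp)
    simp only [fv, length]; omega
  | not φ ih => simp only [fv, length]; omega
  | and φ ψ ih₁ ih₂ | or φ ψ ih₁ ih₂ | imp φ ψ ih₁ ih₂ | iff φ ψ ih₁ ih₂ =>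
    have := Finset.card_union_le φ.fv ψ.fv
    simp only [fv, length]; omega
  | ex x φ ih | all x φ ih =>
    have := Finset.card_erase_le (s := φ.fv) (a := x)
    simp only [fv, length]; omega

theorem fv_exs (xs : List ℕ) (φ : Formula L) : (exs xs φ).fv = φ.fv \ xs.toFinset := by
  induction xs with
  | nil => simp [exs]
  | cons x xs ih =>
    change (exs xs φ).fv.erase x = _
    rw [ih]
    ext y
    simp
    tauto

theorem fv_alls (xs : List ℕ) (φ : Formula L) : (alls xs φ).fv = φ.fv \ xs.toFinset := by
  induction xs with
  | nil => simp [alls]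
  | cons x xs ih =>
    change (alls xs φ).fv.erase x = _
    rw [ih]
    ext y
    simp
    tauto

theorem mem_subs_of_exs_mem {φ χ : Formula L} {xs : List ℕ} (h : exs xs χ ∈ φ.subs) :
    χ ∈ φ.subs := by
  induction xs with
  | nil => exact h
  | cons x xs ih => exact ih (subs_subset h (List.mem_cons_of_mem _ (mem_subs_self _)))

theorem mem_subs_of_alls_mem {φ χ : Formula L} {xs : List ℕ} (h : alls xs χ ∈ φ.subs) :
    χ ∈ φ.subs := by
  induction xs with
  | nil => exact h
  | cons x xs ih => exact ih (subs_subset h (List.mem_cons_of_mem _ (mem_subs_self _)))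

variable {M : Type*} [L.Structure M]

theorem realize_exs {xs : List ℕ} {φ : Formula L} :
    ∀ {f : ℕ → M}, (exs xs φ).Realize f ↔ ∃ g, (∀ y ∉ xs, g y = f y) ∧ φ.Realize g := by
  induction xs with
  | nil =>
    intro f
    constructor
    · exact fun h => ⟨f, fun _ _ => rfl, h⟩
    · rintro ⟨g, hg, h⟩
      obtain rfl : g = f := funext fun y => hg y (by simp)
      exact h
  | cons x xs ih =>
    intro f
    change (∃ a, (exs xs φ).Realize (Function.update f x a)) ↔ _
    constructor
    · rintro ⟨a, h⟩
      obtain ⟨g, hg, h⟩ := ih.1 h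
      refine ⟨g, fun y hy => ?_, h⟩
      simp only [List.mem_cons, not_or] at hy
      simpa [hy.1] using hg y hy.2
    · rintro ⟨g, hg, h⟩
      refine ⟨g x, ih.2 ⟨g, fun y hy => ?_, h⟩⟩
      rcases eq_or_ne y x with rfl | hyx
      · simp
      · simpa [hyx] using hg y (by simp [hyx, hy])

theorem realize_all_iff {x : ℕ} {φ : Formula L} {f : ℕ → M} :
    (all x φ).Realize f ↔ ¬ (ex x (not φ)).Realize f := by simp [Realize]

theorem realize_alls_iff {xs : List ℕ} {γ ψ : Formula L} :
    ∀ {f : ℕ → M}, (alls xs (imp γ ψ)).Realize f ↔ ¬ (exs xs (and γ (not ψ))).Realize f := by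
  induction xs with
  | nil => intro f; simp [alls, exs, Realize]
  | cons x xs ih =>
    intro f
    change (∀ a, (alls xs (imp γ ψ)).Realize (Function.update f x a)) ↔
      ¬ ∃ a, (exs xs (and γ (not ψ))).Realize (Function.update f x a)
    simp only [ih, not_exists]

end Formula

/-! ### Transfer of truth along local maps -/

/-- A family of local maps from `K ⊕ P` to `M` that is closed under restriction, covers all pairs
of points, and has the extension property on sets of size at most `w`. -/
structure LocalMaps {P M : Type*} [DecidableEq P] (G : Finset P → (P → M) → Prop) (w : ℕ) :
    Prop where
  mono : ∀ {S T h}, G T h → S ⊆ T → G S h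
  pair : ∀ {S : Finset P}, S.card ≤ 2 → ∃ h, G S h
  extend : ∀ {S : Finset P} {h}, G S h → S.card ≤ w → ∀ a : M, ∃ b ∉ S,
    G (insert b S) (Function.update h b a)

/-- All points that `f` takes on `V` are in `S`. -/
def Covers {K P : Type*} (f : ℕ → K ⊕ P) (V : Finset ℕ) (S : Finset P) : Prop :=
  ∀ x ∈ V, ∀ p, f x = Sum.inr p → p ∈ S

/-- The points that `f` takes on `V`. -/
def points {K P : Type*} [DecidableEq P] (f : ℕ → K ⊕ P) (V : Finset ℕ) : Finset P :=
  V.biUnion fun x => Sum.elim (fun _ => ∅) (fun p => {p}) (f x)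

section Points

variable {K P : Type*} {f : ℕ → K ⊕ P} {V W : Finset ℕ} {S : Finset P}

theorem mem_points [DecidableEq P] {p : P} : p ∈ points f V ↔ ∃ x ∈ V, f x = Sum.inr p := by
  simp only [points, Finset.mem_biUnion]
  refine exists_congr fun x => and_congr_right fun _ => ?_
  cases f x <;> simp [eq_comm]

theorem covers_points [DecidableEq P] : Covers f V (points f V) := fun x hx _ hp => mem_points.2 ⟨x, hx, hp⟩

theorem Covers.points_subset [DecidableEq P] (h : Covers f V S) : points f V ⊆ S := by
  intro p hp
  obtain ⟨x, hx, e⟩ := mem_points.1 hp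
  exact h x hx p e

theorem Covers.mono (h : Covers f V S) (hW : W ⊆ V) : Covers f W S := fun x hx => h x (hW hx)

theorem card_points_le [DecidableEq P] : (points f V).card ≤ V.card := by
  refine (Finset.card_biUnion_le_card_mul _ _ 1 fun x _ => ?_).trans (by simp)
  cases f x <;> simp

end Points

namespace Formula

variable {K P M : Type*} [L.Structure M] [L.Structure (K ⊕ P)] {κ : K → M}
  {G : Finset P → (P → M) → Prop} {w : ℕ}

/-- Truth in `K ⊕ P` implies truth in `M` along all local maps. -/
def Descends (κ : K → M) (G : Finset P → (P → M) → Prop) (φ : Formula L) : Prop :=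
  ∀ S h (f : ℕ → K ⊕ P), G S h → Covers f φ.fv S →
    φ.Realize f → φ.Realize fun x => Sum.elim κ h (f x)

/-- Truth in `M` along some local map implies truth in `K ⊕ P`. -/
def Lifts (κ : K → M) (G : Finset P → (P → M) → Prop) (φ : Formula L) : Prop :=
  ∀ S h (f : ℕ → K ⊕ P), G S h → Covers f φ.fv S →
    (φ.Realize fun x => Sum.elim κ h (f x)) → φ.Realize f

/-- Truth in `M` does not depend on the local map. -/
def Stable (κ : K → M) (G : Finset P → (P → M) → Prop) (φ : Formula L) : Prop :=
  ∀ S h S' h' (f : ℕ → K ⊕ P), G S h → G S' h' → Covers f φ.fv S → Covers f φ.fv S' →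
    (φ.Realize fun x => Sum.elim κ h (f x)) → φ.Realize fun x => Sum.elim κ h' (f x)

theorem Descends.not {φ : Formula L} (H : φ.Descends κ G) : (not φ).Lifts κ G :=
  fun S h f hG hf hn hφ => hn (H S h f hG hf hφ)

theorem Lifts.not {φ : Formula L} (H : φ.Lifts κ G) : (not φ).Descends κ G :=
  fun S h f hG hf hn hφ => hn (H S h f hG hf hφ)

/-- The extension property supplies a new point that imitates the witness in `M`. -/
theorem Lifts.ex [DecidableEq P] (hG : LocalMaps G w) {φ : Formula L} (H : φ.Lifts κ G) (x : ℕ)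
    (hw : φ.fv.card ≤ w) : (ex x φ).Lifts κ G := by
  rintro S h f hS hf ⟨a, ha⟩
  have hS' := hG.mono hS hf.points_subset
  obtain ⟨b, hb, hb'⟩ := hG.extend hS'
    (card_points_le.trans ((Finset.card_erase_le).trans hw)) a
  refine ⟨Sum.inr b, H _ _ _ hb' ?_ ((φ.realize_congr ?_).1 ha)⟩
  · intro y hy p hp
    rcases eq_or_ne y x with rfl | hyx
    · simp only [Function.update_self, Sum.inr.injEq] at hp
      simp [hp]
    · rw [Function.update_of_ne hyx] at hp
      exact Finset.mem_insert_of_mem (mem_points.2 ⟨y, Finset.mem_erase.2 ⟨hyx, hy⟩, hp⟩)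
  · intro y hy
    rcases eq_or_ne y x with rfl | hyx
    · simp
    · rw [Function.update_of_ne hyx, Function.update_of_ne hyx]
      rcases e : f y with c | p
      · rfl
      · have hp : p ∈ points f (Formula.ex x φ).fv :=
          mem_points.2 ⟨y, Finset.mem_erase.2 ⟨hyx, hy⟩, e⟩
        have : p ≠ b := by rintro rfl; exact hb hp
        simp [this]

theorem Lifts.exs [DecidableEq P] (hG : LocalMaps G w) {φ : Formula L} (H : φ.Lifts κ G) (xs : List ℕ)
    (hw : φ.fv.card ≤ w) : (exs xs φ).Lifts κ G := by
  induction xs with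
  | nil => exact H
  | cons x xs ih =>
    refine Lifts.ex hG ih x (le_trans (Finset.card_le_card ?_) hw)
    rw [fv_exs]
    exact Finset.sdiff_subset

/-- A witness in `K ⊕ P` involves at most two points, which carry some local map `h'`; stability
passes from `h'` to the given `h`. -/
theorem Descends.pairEx [DecidableEq P] (hG : LocalMaps G w) {φ : Formula L} (H : φ.Descends κ G)
    {x y : ℕ} (hxy : φ.fv ⊆ {x, y}) (hst : (ex x φ).Stable κ G) : (ex x φ).Descends κ G := by
  rintro S h f hS hf ⟨b, hb⟩
  set g := Function.update f x b with hg
  obtain ⟨h', hS'⟩ := hG.pair (S := points g φ.fv)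
    (card_points_le.trans ((Finset.card_le_card hxy).trans Finset.card_le_two))
  refine hst _ h' _ h f hS' hS (fun z hz p hp => ?_) hf
    ⟨Sum.elim κ h' b, (φ.realize_congr fun z _ => ?_).1 (H _ _ _ hS' covers_points hb)⟩
  · obtain ⟨hzx, hz⟩ := Finset.mem_erase.1 hz
    exact mem_points.2 ⟨z, hz, by rw [hg, Function.update_of_ne hzx, hp]⟩
  · rcases eq_or_ne z x with rfl | hzx
    · simp [hg]
    · simp [hg, hzx]

/-- The rule for guarded quantifiers; `hγ` says that the guard covers its variables. -/
theorem Descends.guardedEx {γ ψ : Formula L} (Hγ : γ.Descends κ G) (Hψ : ψ.Descends κ G)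
    (hγ : ∀ f : ℕ → K ⊕ P, γ.Realize f → ∃ S h, G S h ∧ Covers f γ.fv S)
    (hfv : ψ.fv ⊆ γ.fv) {xs : List ℕ} (hst : (exs xs (and γ ψ)).Stable κ G) :
    (exs xs (and γ ψ)).Descends κ G := by
  intro S h f hS hf hex
  obtain ⟨g, hg, hγg, hψg⟩ := realize_exs.1 hex
  obtain ⟨S', h', hS', hc⟩ := hγ g hγg
  refine hst _ h' _ h f hS' hS (fun z hz p hp => ?_) hf (realize_exs.2
    ⟨fun z => Sum.elim κ h' (g z), fun z hz => by simp only [hg z hz],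
      Hγ _ _ _ hS' hc hγg, Hψ _ _ _ hS' (hc.mono hfv) hψg⟩)
  rw [fv_exs, Finset.mem_sdiff, List.mem_toFinset] at hz
  refine hc z ?_ p (by rw [hg z hz.2, hp])
  have := hz.1
  simp only [fv, Finset.mem_union] at this
  exact this.elim id fun h => hfv h

/-- The truth of the subformulas in the Triguarded Fragment is preserved by local maps. -/
theorem IsTGF.descends_and_lifts [DecidableEq P] (hG : LocalMaps G w) {φ : Formula L} (hφ : φ.EqFree)
    (hw : ∀ ψ ∈ φ.subs, ψ.fv.card ≤ w) (hst : ∀ ψ ∈ φ.subs, ψ.Stable κ G)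
    (hrel : ∀ {n : ℕ} (R : L.Relations n) ts, rel R ts ∈ φ.subs →
      (rel R ts).Descends κ G ∧ (rel R ts).Lifts κ G)
    (hguard : ∀ {n : ℕ} (R : L.Relations n) ts, rel R ts ∈ φ.subs → ∀ f : ℕ → K ⊕ P,
      (rel R ts).Realize f → ∃ S h, G S h ∧ Covers f (rel R ts).fv S)
    {ψ : Formula L} (hψ : ψ.IsTGF) :
    ψ ∈ φ.subs → ψ.Descends κ G ∧ ψ.Lifts κ G := by
  have atom : ∀ {γ : Formula L}, γ.IsAtom → γ ∈ φ.subs → (γ.Descends κ G ∧ γ.Lifts κ G) ∧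
      ∀ f : ℕ → K ⊕ P, γ.Realize f → ∃ S h, G S h ∧ Covers f γ.fv S := by
    intro γ hγ hmem
    cases hγ with
    | eq s t => exact (hφ.of_mem_subs hmem).elim
    | rel R ts => exact ⟨hrel R ts hmem, hguard R ts hmem⟩
  have bin : ∀ {α β : Formula L} {S : Finset P} {f : ℕ → K ⊕ P},
      Covers f (α.fv ∪ β.fv) S → Covers f α.fv S ∧ Covers f β.fv S := fun h =>
    ⟨h.mono Finset.subset_union_left, h.mono Finset.subset_union_right⟩
  induction hψ with
  | atom hγ => exact fun hmem => (atom hγ hmem).1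
  | top => exact fun _ => ⟨fun _ _ _ _ _ h => h, fun _ _ _ _ _ h => h⟩
  | bot => exact fun _ => ⟨fun _ _ _ _ _ h => h, fun _ _ _ _ _ h => h⟩
  | not _ ih =>
    intro hmem
    have ih := ih (subs_subset hmem (List.mem_cons_of_mem _ (mem_subs_self _)))
    exact ⟨ih.2.not, ih.1.not⟩
  | and _ _ ih₁ ih₂ =>
    intro hmem
    have ih₁ := ih₁ (subs_subset hmem (by simp [subs, mem_subs_self]))
    have ih₂ := ih₂ (subs_subset hmem (by simp [subs, mem_subs_self]))
    exact ⟨fun S h f hS hf H => ⟨ih₁.1 S h f hS (bin hf).1 H.1, ih₂.1 S h f hS (bin hf).2 H.2⟩,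
      fun S h f hS hf H => ⟨ih₁.2 S h f hS (bin hf).1 H.1, ih₂.2 S h f hS (bin hf).2 H.2⟩⟩
  | or _ _ ih₁ ih₂ =>
    intro hmem
    have ih₁ := ih₁ (subs_subset hmem (by simp [subs, mem_subs_self]))
    have ih₂ := ih₂ (subs_subset hmem (by simp [subs, mem_subs_self]))
    exact ⟨fun S h f hS hf => Or.imp (ih₁.1 S h f hS (bin hf).1) (ih₂.1 S h f hS (bin hf).2),
      fun S h f hS hf => Or.imp (ih₁.2 S h f hS (bin hf).1) (ih₂.2 S h f hS (bin hf).2)⟩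
  | imp _ _ ih₁ ih₂ =>
    intro hmem
    have ih₁ := ih₁ (subs_subset hmem (by simp [subs, mem_subs_self]))
    have ih₂ := ih₂ (subs_subset hmem (by simp [subs, mem_subs_self]))
    exact ⟨fun S h f hS hf H a => ih₂.1 S h f hS (bin hf).2 (H (ih₁.2 S h f hS (bin hf).1 a)),
      fun S h f hS hf H a => ih₂.2 S h f hS (bin hf).2 (H (ih₁.1 S h f hS (bin hf).1 a))⟩
  | iff _ _ ih₁ ih₂ =>
    intro hmem
    have ih₁ := ih₁ (subs_subset hmem (by simp [subs, mem_subs_self]))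
    have ih₂ := ih₂ (subs_subset hmem (by simp [subs, mem_subs_self]))
    constructor <;> intro S h f hS hf H
    · exact (iff_congr ⟨ih₁.1 S h f hS (bin hf).1, ih₁.2 S h f hS (bin hf).1⟩
        ⟨ih₂.1 S h f hS (bin hf).2, ih₂.2 S h f hS (bin hf).2⟩).1 H
    · exact (iff_congr ⟨ih₁.1 S h f hS (bin hf).1, ih₁.2 S h f hS (bin hf).1⟩
        ⟨ih₂.1 S h f hS (bin hf).2, ih₂.2 S h f hS (bin hf).2⟩).2 H
  | guardedEx xs hγ _ hfv _ ih =>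
    intro hmem
    have hand := mem_subs_of_exs_mem hmem
    have ih := ih (subs_subset hand (by simp [subs, mem_subs_self]))
    obtain ⟨⟨hd, hl⟩, hg⟩ := atom hγ (subs_subset hand (by simp [subs, mem_subs_self]))
    exact ⟨Descends.guardedEx hd ih.1 hg hfv (hst _ hmem), Lifts.exs hG
      (φ := .and _ _) (fun S h f hS hf H => ⟨hl S h f hS (bin hf).1 H.1, ih.2 S h f hS (bin hf).2 H.2⟩) xs
      (hw _ hand)⟩
  | @guardedAll xs γ ψ hγ _ hfv _ ih =>
    intro hmem
    have himp := mem_subs_of_alls_mem hmem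
    have ih := ih (subs_subset himp (by simp [subs, mem_subs_self]))
    obtain ⟨⟨hd, hl⟩, hg⟩ := atom hγ (subs_subset himp (by simp [subs, mem_subs_self]))
    have hfveq : (exs xs (.and γ (.not ψ))).fv = (alls xs (.imp γ ψ)).fv := by
      rw [fv_exs, fv_alls]; rfl
    -- Universal quantifiers are negations of existential ones, and stability passes to negations by
    -- exchanging the two local maps.
    have hst' : (exs xs (.and γ (.not ψ))).Stable κ G := by
      intro S h S' h' f hS hS' hf hf' H
      by_contra hcon
      rw [← realize_alls_iff] at hcon
      rw [hfveq] at hf hf'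
      exact realize_alls_iff.1 (hst _ hmem S' h' S h f hS' hS hf' hf hcon) H
    have h1 := Descends.guardedEx hd ih.2.not hg hfv hst'
    have h2 : (exs xs (.and γ (.not ψ))).Lifts κ G := Lifts.exs hG
      (φ := .and _ _) (fun S h f hS hf H => ⟨hl S h f hS (bin hf).1 H.1, ih.1.not S h f hS (bin hf).2 H.2⟩) xs
      (hw (.imp γ ψ) himp)
    constructor <;> intro S h f hS hf H <;> rw [realize_alls_iff] at H ⊢ <;>
      rw [← hfveq] at hf
    · exact fun H' => H (h2 S h f hS hf H')
    · exact fun H' => H (h1 S h f hS hf H')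
  | pairEx x y _ hfv ih =>
    intro hmem
    have hm := subs_subset hmem (List.mem_cons_of_mem _ (mem_subs_self _))
    exact ⟨(ih hm).1.pairEx hG hfv (hst _ hmem), (ih hm).2.ex hG x (hw _ hm)⟩
  | @pairAll x y ψ _ hfv ih =>
    intro hmem
    have hm := subs_subset hmem (List.mem_cons_of_mem _ (mem_subs_self _))
    have hst' : (ex x (.not ψ)).Stable κ G := by
      intro S h S' h' f hS hS' hf hf' H
      by_contra hcon
      rw [← realize_all_iff] at hcon
      exact realize_all_iff.1 (hst _ hmem S' h' S h f hS' hS hf' hf hcon) H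
    have h1 := (ih hm).2.not.pairEx hG hfv hst'
    have h2 := (ih hm).1.not.ex hG x (hw ψ hm)
    constructor <;> intro S h f hS hf H <;> rw [realize_all_iff] at H ⊢
    · exact fun H' => H (h2 S h f hS hf H')
    · exact fun H' => H (h1 S h f hS hf H')

end Formula

end TGF

/-! ### The finite model -/

namespace TGF

variable {L : FirstOrder.Language.{u, v}}

namespace Formula

/-- The symbols whose instances are decided in a finite model: the subformulas of `φ`, taken as
relations on assignments of their free variables, and the relation symbols of `φ`. -/
abbrev Symb (φ : Formula L) : Type (max u v) :=
  {ψ : Formula L // ψ ∈ φ.subs} ⊕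
    {R : Σ n, L.Relations n // ∃ ts, rel R.2 ts ∈ φ.subs}

/-- The argument positions of a symbol. -/
def Symb.Arity {φ : Formula L} : φ.Symb → Type
  | .inl ψ => {x // x ∈ ψ.1.fv}
  | .inr R => Fin R.1.1

noncomputable instance {φ : Formula L} : ∀ i : φ.Symb, Fintype i.Arity
  | .inl ψ => inferInstanceAs (Fintype {x // x ∈ ψ.1.fv})
  | .inr R => inferInstanceAs (Fintype (Fin R.1.1))

theorem Symb.card_arity_le {φ : Formula L} (i : φ.Symb) : Fintype.card i.Arity ≤ φ.length := by
  rcases i with ⟨ψ, hψ⟩ | ⟨⟨n, R⟩, ts, h⟩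
  · calc Fintype.card {x // x ∈ ψ.fv} = ψ.fv.card := Fintype.card_coe _
      _ ≤ _ := ψ.card_fv_le_length.trans (length_le_of_mem_subs hψ)
  · calc Fintype.card (Fin n) = n := Fintype.card_fin n
      _ ≤ (rel R ts).length := Nat.le_add_right _ _
      _ ≤ _ := length_le_of_mem_subs h

noncomputable instance (φ : Formula L) : Fintype {ψ : Formula L // ψ ∈ φ.subs} := by
  classical exact Fintype.subtype φ.subs.toFinset (by simp)

theorem card_subs_le (φ : Formula L) :
    Fintype.card {ψ : Formula L // ψ ∈ φ.subs} ≤ φ.length := by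
  classical
  rw [Fintype.subtype_card]
  exact (List.toFinset_card_le _).trans φ.length_subs_le

/-- An occurrence of each relation symbol. -/
noncomputable def occurrence (φ : Formula L)
    (R : {R : Σ n, L.Relations n // ∃ ts, rel R.2 ts ∈ φ.subs}) :
    {ψ : Formula L // ψ ∈ φ.subs} := ⟨rel R.1.2 R.2.choose, R.2.choose_spec⟩

theorem occurrence_injective (φ : Formula L) : Function.Injective φ.occurrence := by
  rintro ⟨⟨n, R⟩, hR⟩ ⟨⟨m, T⟩, hT⟩ h
  have h := congrArg Subtype.val h
  simp only [occurrence, rel.injEq] at h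
  obtain ⟨rfl, h, -⟩ := h
  obtain rfl := eq_of_heq h
  rfl

noncomputable instance (φ : Formula L) :
    Fintype {R : Σ n, L.Relations n // ∃ ts, rel R.2 ts ∈ φ.subs} :=
  Fintype.ofInjective _ φ.occurrence_injective

theorem card_symb_le (φ : Formula L) : Fintype.card φ.Symb ≤ 2 * φ.length := by
  have h1 := φ.card_subs_le
  have h2 := Fintype.card_le_of_injective _ φ.occurrence_injective
  rw [Fintype.card_sum]
  omega

/-- The truth value of an instance of a symbol in a structure. -/
def Symb.Interp {M : Type*} [L.Structure M] (a₀ : M) {φ : Formula L} :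
    ∀ i : φ.Symb, (i.Arity → M) → Prop
  | .inl ψ, g => by
    classical exact ψ.1.Realize fun x => if hx : x ∈ ψ.1.fv then g ⟨x, hx⟩ else a₀
  | .inr R, g => FirstOrder.Language.Structure.RelMap R.1.2 g

/-- The finite model property of the Triguarded Fragment without equality, with an explicit
bound. -/
theorem exists_finite_model {φ : Formula L} (hs : φ.IsSentence) (ht : φ.IsTGF) (he : φ.EqFree)
    (hlen : 1 ≤ φ.length) {M : Type*} [Nonempty M] [L.Structure M] (hM : φ.HasModel M) (q : ℕ)
    (hq : 2 * φ.length * (2 * φ.length + 1) ^ φ.length ≤ q) :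
    ∃ _ : L.Structure (Fin φ.consts.length ⊕ Fin (2 ^ (4 * q))),
      φ.HasModel (Fin φ.consts.length ⊕ Fin (2 ^ (4 * q))) := by
  classical
  have a₀ : M := Classical.arbitrary M
  have hone : 1 ≤ (2 * φ.length + 1) ^ φ.length := Nat.one_le_pow _ _ (Nat.succ_pos _)
  have hlq : φ.length ≤ q := by nlinarith
  let κ : Fin φ.consts.length → M := fun i => (φ.consts.get i : M)
  have hsum : ∑ i : φ.Symb, (Fintype.card (Fin φ.consts.length) + (φ.length + 1)) ^
      Fintype.card i.Arity ≤ q := by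
    have hb : φ.consts.length + (φ.length + 1) ≤ 2 * φ.length + 1 := by
      have := φ.length_consts_le
      omega
    refine le_trans ?_ hq
    refine (Finset.sum_le_card_nsmul _ _ ((2 * φ.length + 1) ^ φ.length) fun i _ => ?_).trans ?_
    · rw [Fintype.card_fin]
      exact (Nat.pow_le_pow_left hb _).trans
        (Nat.pow_le_pow_right (Nat.succ_pos _) i.card_arity_le)
    · rw [smul_eq_mul, Finset.card_univ]
      exact Nat.mul_le_mul_right _ φ.card_symb_le
  obtain ⟨v, G, hv, hmono, hpair, hguard, hext⟩ := exists_saturated_valuation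
    (fun i : φ.Symb => i.Interp a₀) κ φ.length q hsum hlq (hlen.trans hlq)
  let P := Fin (2 ^ (4 * q))
  let N := Fin φ.consts.length ⊕ P
  have hG : LocalMaps G φ.length := ⟨fun H h => hmono _ _ _ H h, hpair _, fun H h => hext _ _ H h⟩
  -- Constants outside `φ` get an arbitrary point and relation symbols outside `φ` are empty. A
  -- constant with several occurrences denotes one chosen occurrence.
  let str : L.Structure N :=
    { funMap := fun {n} => match n with
        | 0 => fun c _ => if h : ∃ i, φ.consts.get i = c then Sum.inl h.choose
            else Sum.inr ⟨0, by positivity⟩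
        | _ + 1 => fun _ _ => Sum.inr ⟨0, by positivity⟩
      RelMap := fun {n} R x => ∃ h : ∃ ts, rel R ts ∈ φ.subs, v (.inr ⟨⟨n, R⟩, h⟩) x }
  have hconst : ∀ c ∈ φ.consts, ∃ i, (c : N) = Sum.inl i ∧ κ i = (c : M) := by
    intro c hc
    have h : ∃ i, φ.consts.get i = c := List.mem_iff_get.1 hc
    refine ⟨h.choose, ?_, ?_⟩
    · change (if h : ∃ i, φ.consts.get i = c then Sum.inl h.choose
        else Sum.inr ⟨0, by positivity⟩ : N) = _
      rw [dif_pos h]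
    · change (φ.consts.get h.choose : M) = c
      rw [h.choose_spec]
  have hval : ∀ (t : Term L), (∀ c ∈ t.consts, c ∈ φ.consts) → ∀ (h : P → M) (f : ℕ → N),
      t.val (fun x => Sum.elim κ h (f x)) = Sum.elim κ h (t.val f) := by
    intro t hc h f
    cases t with
    | var x => rfl
    | const c =>
      obtain ⟨i, h1, h2⟩ := hconst c (hc c (by simp [Term.consts]))
      simp only [Term.val, h1, Sum.elim_inl, h2]
  have hpt : ∀ (t : Term L), (∀ c ∈ t.consts, c ∈ φ.consts) → ∀ (f : ℕ → N) (p : P),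
      t.val f = Sum.inr p → ∃ x ∈ t.fv, f x = Sum.inr p := by
    intro t hc f p h
    cases t with
    | var x => exact ⟨x, by simp [Term.fv], h⟩
    | const c =>
      obtain ⟨i, h1, -⟩ := hconst c (hc c (by simp [Term.consts]))
      simp only [Term.val, h1] at h
      cases h
  -- Subformulas are symbols themselves, so `v` fixes their truth value in `M` for all local maps
  -- simultaneously.
  have hstab : ∀ ψ, ∀ hψ : ψ ∈ φ.subs, ∀ (S : Finset P) h (f : ℕ → N), G S h → Covers f ψ.fv S →
      (v (.inl ⟨ψ, hψ⟩) (fun x => f x.1) ↔ ψ.Realize fun x => Sum.elim κ h (f x)) := by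
    intro ψ hψ S h f hS hf
    rw [hv S h hS (.inl ⟨ψ, hψ⟩) _ fun x p => hf x.1 x.2 p]
    refine realize_congr ψ fun x hx => ?_
    simp [hx]
  have hcsub : ∀ {n : ℕ} (R : L.Relations n) ts, rel R ts ∈ φ.subs → ∀ i,
      ∀ c ∈ (ts i).consts, c ∈ φ.consts := fun R ts h i c hc => consts_subset h
    (List.mem_flatMap.2 ⟨i, List.mem_finRange i, hc⟩)
  have hrel : ∀ {n : ℕ} (R : L.Relations n) ts, rel R ts ∈ φ.subs →
      ∀ (S : Finset P) h (f : ℕ → N), G S h → Covers f (rel R ts).fv S →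
      ((rel R ts).Realize f ↔ (rel R ts).Realize fun x => Sum.elim κ h (f x)) := by
    intro n R ts hmem S h f hS hf
    have hex : ∃ ts, rel R ts ∈ φ.subs := ⟨ts, hmem⟩
    have h1 : (rel R ts).Realize f ↔ v (.inr ⟨⟨n, R⟩, hex⟩) fun i : Fin n => (ts i).val f :=
      ⟨fun ⟨_, H⟩ => H, fun H => ⟨hex, H⟩⟩
    refine h1.trans ((hv S h hS (.inr ⟨⟨n, R⟩, hex⟩) (fun i : Fin n => (ts i).val f) ?_).trans
      (Iff.symm ?_))
    rotate_left
    · have h2 : (fun i => (ts i).val fun x => Sum.elim κ h (f x)) =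
          fun i => Sum.elim κ h ((ts i).val f) :=
        funext fun i => hval (ts i) (hcsub R ts hmem i) h f
      simp only [Realize, h2]
      rfl
    · intro i p hp
      obtain ⟨x, hx, hfx⟩ := hpt (ts i) (hcsub R ts hmem i) f p hp
      exact hf x (Finset.mem_biUnion.2 ⟨i, Finset.mem_univ _, hx⟩) p hfx
  have hmain := IsTGF.descends_and_lifts (κ := κ) hG he
    (fun ψ hψ => ψ.card_fv_le_length.trans (length_le_of_mem_subs hψ))
    (fun ψ hψ S h S' h' f hS hS' hf hf' H =>
      (hstab ψ hψ S' h' f hS' hf').1 ((hstab ψ hψ S h f hS hf).2 H))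
    (fun R ts hmem => ⟨fun S h f hS hf => (hrel R ts hmem S h f hS hf).1,
      fun S h f hS hf => (hrel R ts hmem S h f hS hf).2⟩)
    (fun R ts hmem f => by
      rintro ⟨hex, H⟩
      obtain ⟨S, h, hS, hx⟩ := hguard _ _ H
      refine ⟨S, h, hS, fun x hx' p hp => ?_⟩
      obtain ⟨i, -, hi⟩ := Finset.mem_biUnion.1 hx'
      refine hx i p ?_
      cases e : ts i with
      | var y =>
        rw [e] at hi
        obtain rfl : x = y := by simpa [Term.fv] using hi
        exact hp
      | const c => rw [e] at hi; simp [Term.fv] at hi)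
    ht φ.mem_subs_self
  refine ⟨str, fun f => ?_⟩
  obtain ⟨h, hh⟩ := hG.pair (S := ∅) (by simp)
  refine hmain.2 ∅ h f hh (fun x hx => ?_) (hM _)
  rw [show φ.fv = ∅ from hs] at hx
  simp at hx

end Formula

/-! ### The numerical bound -/

theorem card_bound_le {n c : ℕ} (hn : 2 ≤ n) (hc : c ≤ n) :
    c + 2 ^ (4 * (2 * n * (2 * n + 1) ^ n)) ≤ 2 ^ (n ^ (10 * n)) := by
  have h1 : 2 * n + 1 ≤ n ^ 3 := by nlinarith [Nat.mul_le_mul hn hn]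
  have h2 : 4 * (2 * n * (2 * n + 1) ^ n) ≤ n ^ (3 * n + 4) := by
    calc 4 * (2 * n * (2 * n + 1) ^ n) = 2 ^ 3 * n * (2 * n + 1) ^ n := by ring
      _ ≤ n ^ 3 * n * (n ^ 3) ^ n := by gcongr
      _ = n ^ (3 * n + 4) := by rw [← pow_mul]; ring
  have h3 : n ≤ 2 ^ n := Nat.lt_two_pow_self.le
  have h4 : n ≤ n ^ (3 * n + 4) := Nat.le_self_pow (by omega) n
  have h5 : n ^ (3 * n + 4) + 1 ≤ n ^ (10 * n) := by
    calc n ^ (3 * n + 4) + 1 ≤ n ^ (3 * n + 4) * 2 := by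
          have : 1 ≤ n ^ (3 * n + 4) := Nat.one_le_pow _ _ (by omega)
          omega
      _ ≤ n ^ (3 * n + 4) * n := by gcongr
      _ = n ^ (3 * n + 5) := by rw [← pow_succ]
      _ ≤ n ^ (10 * n) := Nat.pow_le_pow_right (by omega) (by omega)
  calc c + 2 ^ (4 * (2 * n * (2 * n + 1) ^ n))
      ≤ 2 ^ (n ^ (3 * n + 4)) + 2 ^ (n ^ (3 * n + 4)) := by
        gcongr
        · exact (hc.trans h3).trans (Nat.pow_le_pow_right two_pos h4)
        · norm_num
    _ = 2 ^ (n ^ (3 * n + 4) + 1) := by rw [pow_succ]; ring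
    _ ≤ _ := Nat.pow_le_pow_right two_pos h5

/-- The divisor `Real.log 2` in the constant turns the natural logarithm into the binary one. -/
theorem two_rpow_eq_pow {n : ℕ} (hn : 1 ≤ n) :
    (2 : ℝ) ^ ((10 / Real.log 2) * (n : ℝ) * Real.log n) = ((n ^ (10 * n) : ℕ) : ℝ) := by
  have hn' : (0 : ℝ) < n := by exact_mod_cast hn
  have hl : Real.log 2 ≠ 0 := (Real.log_pos one_lt_two).ne'
  rw [Real.rpow_def_of_pos two_pos]
  have : Real.log 2 * (10 / Real.log 2 * n * Real.log n) = Real.log ((n : ℝ) ^ (10 * n)) := by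
    rw [Real.log_pow]
    push_cast
    field_simp
  rw [this, Real.exp_log (by positivity)]
  push_cast
  rfl

theorem Formula.one_le_length (φ : Formula L) : 1 ≤ φ.length := by
  cases φ <;> simp only [Formula.length] <;> omega

theorem Formula.eq_top_or_bot_of_length (φ : Formula L) (h : φ.length ≤ 1) :
    φ = Formula.top ∨ φ = Formula.bot := by
  cases φ with
  | top => exact Or.inl rfl
  | bot => exact Or.inr rfl
  | not φ | ex x φ | all x φ =>
    have := φ.one_le_length
    simp only [Formula.length] at h
    omega
  | _ => simp only [Formula.length] at h; omega

end TGF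

theorem theorem3 :
    ∃ C : ℝ, 0 < C ∧
      ∀ (L : FirstOrder.Language.{u, v}) [∀ n, IsEmpty (L.Functions (n + 1))]
        [IsEmpty (L.Relations 0)] (φ : TGF.Formula L),
        φ.IsSentence → φ.IsTGF → φ.EqFree →
        (∃ (M : Type w) (_ : Nonempty M) (_ : L.Structure M), φ.HasModel M) →
        ∃ (N : Type) (_ : Nonempty N) (_ : Finite N) (_ : L.Structure N),
          φ.HasModel N ∧
          (Nat.card N : ℝ) ≤
            (2 : ℝ) ^ ((2 : ℝ) ^ (C * (φ.length : ℝ) * Real.log (φ.length : ℝ))) := by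
  refine ⟨10 / Real.log 2, div_pos (by norm_num) (Real.log_pos one_lt_two), ?_⟩
  rintro L _ _ φ hs ht he ⟨M, hM, hstr, hmod⟩
  rw [TGF.two_rpow_eq_pow φ.one_le_length, Real.rpow_natCast]
  -- At length 1 the logarithm vanishes and the bound is only 2, so a one-point model is given
  -- directly.
  rcases (by omega : φ.length ≤ 1 ∨ 2 ≤ φ.length) with h | h
  · refine ⟨Unit, inferInstance, inferInstance,
      { funMap := fun _ _ => (), RelMap := fun _ _ => False }, ?_, ?_⟩
    · rcases φ.eq_top_or_bot_of_length h with rfl | rfl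
      · exact fun _ => trivial
      · exact (hmod fun _ => hM.some).elim
    · rw [Nat.card_unique, Nat.cast_one]
      exact one_le_pow₀ (by norm_num)
  · obtain ⟨str, hN⟩ := TGF.Formula.exists_finite_model hs ht he (by omega) hmod _ le_rfl
    refine ⟨_, ⟨Sum.inr ⟨0, by positivity⟩⟩, inferInstance, str, hN, ?_⟩
    rw [Nat.card_sum, Nat.card_fin, Nat.card_fin]
    exact_mod_cast TGF.card_bound_le h φ.length_consts_le
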